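/- Let $G$ be a profinite group with a countable base of its topology. Let $\mathcal{O}(G)$ be the space of locally constant ("holomorphic") functions $G\to\mathbb{C}$, with the topology of the locally convex inductive limit of the finite-dimensional spaces of functions that are constant on the classes of a partition $\alpha$ of $G$ into finitely many open subsets, over all such $\alpha$. Let $\mathcal{O}(G)'$ be its strong dual, with the convolution product $(S*T)(f)=S_x\bigl(T_y(f(xy))\bigr)$, whose unit is the evaluation at the identity of $G$. An Arens--Michael algebra is a complete Hausdorff topological algebra over $\mathbb{C}$ whose topology is given by a family of submultiplicative seminorms. Then $\mathcal{O}(G)'$ is an Arens--Michael algebra. Moreover, $G$ is (topologically isomorphic to) the projective limit of a sequence $\cdots\to G_2\to G_1\to G_0$ of finite groups and homomorphisms, and for every such sequence $(G_n)$ and every topological isomorphism $G\cong\varprojlim G_n$ there is an isomorphism of topological algebras $$\Phi\colon \mathcal{O}(G)'\to\varprojlim \mathbb{C}G_n$$ onto the projective limit of the finite-dimensional group algebras, namely the canonical one: for every $T\in\mathcal{O}(G)'$, every $n$ and every $h\colon G_n\to\mathbb{C}$, the $n$-th component $\sum_{g\in G_n}c_g\,g$ of $\Phi(T)$ satisfies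 $\sum_{g\in G_n} c_g\,h(g)=T(h\circ\pi_n)$, where $\pi_n\colon G\to G_n$ is the projection. -/

import Mathlib

universe u v

noncomputable section

open Topology

/-! ### Holomorphic functions on a profinite group -/

/-- `HolFun G` is the algebra `𝒪(G)` of holomorphic functions on a profinite group `G`,
that is, of locally constant complex-valued functions. -/
abbrev HolFun (G : Type u) [TopologicalSpace G] : Type u := LocallyConstant G ℂ

namespace HolFun

section Topology

variable {G : Type u} [TopologicalSpace G]

/-- A partition `α` of `G` into open subsets is a `DiscreteQuotient G` (there are finitely many
classes when `G` is compact). The functions on `G` which are constant on each class of `α` are the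
functions on the quotient `α`; this is the inclusion `ℂ^α → 𝒪(G)` of these functions. -/
def ofPartition (α : DiscreteQuotient G) : (α → ℂ) →ₗ[ℂ] HolFun G where
  toFun h := ⟨fun x => h (α.proj x), α.proj_isLocallyConstant.comp h⟩
  map_add' _ _ := rfl
  map_smul' _ _ := rfl

/-- The vector space topologies on `𝒪(G)` that are locally convex and for which the inclusions
of all the finite-dimensional spaces `ℂ^α` (with their usual topology) are continuous. -/
def inductiveTopologies (G : Type u) [TopologicalSpace G] : Set (TopologicalSpace (HolFun G)) :=
  {t | @IsTopologicalAddGroup (HolFun G) t _ ∧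
    @ContinuousSMul ℂ (HolFun G) _ _ t ∧
    @LocallyConvexSpace ℝ (HolFun G) _ _ _ _ t ∧
    ∀ α : DiscreteQuotient G, @Continuous (α → ℂ) (HolFun G) _ t (ofPartition α)}

/-- `𝒪(G)`, for compact `G`, with the topology of the locally convex inductive limit of the spaces
`ℂ^α`, where `α` runs over the partitions of `G` into finitely many open subsets: the finest
locally convex topology for which all inclusions `ℂ^α → 𝒪(G)` are continuous. -/
instance instTopologicalSpace [CompactSpace G] : TopologicalSpace (HolFun G) :=
  sInf (inductiveTopologies G)

variable [CompactSpace G]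

instance instIsTopologicalAddGroup : IsTopologicalAddGroup (HolFun G) :=
  topologicalAddGroup_sInf fun _ ht => ht.1

instance instContinuousSMul : ContinuousSMul ℂ (HolFun G) :=
  continuousSMul_sInf fun _ ht => ht.2.1

instance instLocallyConvexSpace : LocallyConvexSpace ℝ (HolFun G) :=
  LocallyConvexSpace.sInf fun _ ht => ht.2.2.1

/-- Every linear functional on `𝒪(G)` is continuous. -/
theorem continuous_linear (T : HolFun G →ₗ[ℂ] ℂ) : Continuous T := by
  have hmem : TopologicalSpace.induced T inferInstance ∈ inductiveTopologies G := by
    refine ⟨topologicalAddGroup_induced T, continuousSMul_induced T, ?_, fun α => ?_⟩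
    · exact LocallyConvexSpace.induced (T.restrictScalars ℝ)
    · rw [continuous_induced_rng]
      exact (T ∘ₗ ofPartition α).continuous_of_finiteDimensional
  exact continuous_iff_le_induced.2 (sInf_le hmem)

end Topology

section Convolution

variable {G : Type u} [Group G] [TopologicalSpace G] [IsTopologicalGroup G]

/-- The left translate `y ↦ f (x * y)`. -/
def translate (x : G) (f : HolFun G) : HolFun G :=
  ⟨fun y => f (x * y), f.isLocallyConstant.comp_continuous (continuous_const_mul x)⟩

@[simp] theorem translate_apply (x : G) (f : HolFun G) (y : G) : translate x f y = f (x * y) := rfl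

variable [CompactSpace G]

theorem isLocallyConstant_translate (f : HolFun G) :
    IsLocallyConstant fun x => translate x f := by
  rw [IsLocallyConstant.iff_eventually_eq]
  intro x₀
  have hopen : IsOpen {p : G × G | f (p.1 * p.2) = f (x₀ * p.2)} := by
    have h1 : IsLocallyConstant fun p : G × G => f (p.1 * p.2) :=
      f.isLocallyConstant.comp_continuous continuous_mul
    have h2 : IsLocallyConstant fun p : G × G => f (x₀ * p.2) :=
      f.isLocallyConstant.comp_continuous (continuous_const.mul continuous_snd)
    have h3 := (h1.prodMk h2) {q : ℂ × ℂ | q.1 = q.2}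
    exact h3
  obtain ⟨u, v, hu, -, hxu, hv, huv⟩ := generalized_tube_lemma (s := {x₀}) isCompact_singleton
    (t := Set.univ) isCompact_univ hopen (by rintro ⟨a, b⟩ ⟨ha, -⟩; simp_all)
  filter_upwards [hu.mem_nhds (hxu rfl)] with x hx
  ext y
  exact huv (Set.mk_mem_prod hx (hv (Set.mem_univ y)))

/-- The function `x ↦ T_y (f (x * y))` for a functional `T` on `𝒪(G)`. -/
def slice (T : StrongDual ℂ (HolFun G)) : HolFun G →ₗ[ℂ] HolFun G where
  toFun f := ⟨fun x => T (translate x f), (isLocallyConstant_translate f).comp T⟩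
  map_add' f g := by ext x; exact map_add T (translate x f) (translate x g)
  map_smul' c f := by ext x; exact map_smul T c (translate x f)

@[simp] theorem slice_apply (T : StrongDual ℂ (HolFun G)) (f : HolFun G) (x : G) :
    slice T f x = T (translate x f) := rfl

/-- Convolution `S * T : f ↦ S_x (T_y (f (x * y)))` on `𝒪(G)'`, the dual of the comultiplication
`f ↦ ((x, y) ↦ f (x * y))`. -/
instance instMulDual : Mul (StrongDual ℂ (HolFun G)) where
  mul S T := ⟨S.toLinearMap ∘ₗ slice T, continuous_linear _⟩

/-- The unit of `𝒪(G)'` is the evaluation at the identity. -/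
instance instOneDual : One (StrongDual ℂ (HolFun G)) where
  one := ⟨LocallyConstant.evalₗ ℂ 1, continuous_linear _⟩

@[simp] theorem mul_dual_apply (S T : StrongDual ℂ (HolFun G)) (f : HolFun G) :
    (S * T) f = S (slice T f) := rfl

@[simp] theorem one_dual_apply (f : HolFun G) :
    (1 : StrongDual ℂ (HolFun G)) f = f 1 := rfl

/-- The convolution algebra `𝒪(G)'`. -/
instance instRingDual : Ring (StrongDual ℂ (HolFun G)) where
  __ := (inferInstance : AddCommGroup (StrongDual ℂ (HolFun G)))
  mul := (· * ·)
  one := 1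
  left_distrib S T T' := by
    ext f
    exact map_add S (slice T f) (slice T' f)
  right_distrib S S' T := rfl
  zero_mul S := rfl
  mul_zero S := by
    ext f
    exact map_zero S
  mul_assoc S T U := by
    ext f
    refine congrArg S (LocallyConstant.ext fun x => ?_)
    refine congrArg T (LocallyConstant.ext fun y => ?_)
    refine congrArg U (LocallyConstant.ext fun z => ?_)
    simp [mul_assoc]
  one_mul S := by
    ext f
    change S (translate 1 f) = S f
    exact congrArg S (LocallyConstant.ext fun y => by simp)
  mul_one S := by
    ext f
    exact congrArg S (LocallyConstant.ext fun y => by simp)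

instance instAlgebraDual : Algebra ℂ (StrongDual ℂ (HolFun G)) :=
  Algebra.ofModule (fun _ _ _ => rfl) fun c S T => by
    ext f
    exact map_smul S c (slice T f)

end Convolution

end HolFun

/-! ### Arens–Michael algebras -/

/-- An Arens–Michael algebra: a complete Hausdorff topological algebra over `ℂ` whose topology is
given by a family of submultiplicative prenorms (seminorms). -/
structure IsArensMichaelAlgebra (A : Type u) [Ring A] [Algebra ℂ A] [UniformSpace A] : Prop where
  /-- The uniform structure is the one of the additive topological group `A`. -/
  isUniformAddGroup : IsUniformAddGroup A
  t2Space : T2Space A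
  completeSpace : CompleteSpace A
  exists_seminorms : ∃ P : Set (Seminorm ℂ A),
    (∀ p ∈ P, ∀ a b : A, p (a * b) ≤ p a * p b) ∧
      WithSeminorms (fun p : P => (p : Seminorm ℂ A))

/-! ### Projective sequences of finite groups -/

/-- A sequence of finite groups `⋯ → G₂ → G₁ → G₀`. -/
structure FiniteGroupSeq where
  /-- The groups of the sequence. -/
  obj : ℕ → Type v
  [group : ∀ n, Group (obj n)]
  [finite : ∀ n, Finite (obj n)]
  /-- The linking homomorphisms. -/
  link : ∀ n, obj (n + 1) →* obj n

namespace FiniteGroupSeq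

attribute [instance] FiniteGroupSeq.group FiniteGroupSeq.finite

variable (S : FiniteGroupSeq.{v})

/-- The finite groups `Gₙ` are discrete. -/
instance instTopologicalSpaceObj (n : ℕ) : TopologicalSpace (S.obj n) := ⊥

instance instDiscreteTopologyObj (n : ℕ) : DiscreteTopology (S.obj n) := ⟨rfl⟩

/-- The projective limit `lim Gₙ`, a topological group as a subgroup of the product `∏ Gₙ`. -/
def limit : Subgroup (∀ n, S.obj n) where
  carrier := {x | ∀ n, S.link n (x (n + 1)) = x n}
  mul_mem' := by
    intro a b ha hb n
    simp only [Pi.mul_apply, map_mul, ha n, hb n]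
  one_mem' := by
    intro n
    simp
  inv_mem' := by
    intro a ha n
    simp only [Pi.inv_apply, map_inv, ha n]

/-- The finite-dimensional group algebra `ℂGₙ`. -/
abbrev GroupAlg (n : ℕ) : Type v := MonoidAlgebra ℂ (S.obj n)

/-- The usual topology of the finite-dimensional space `ℂGₙ`: convergence of all coefficients. -/
instance instTopologicalSpaceGroupAlg (n : ℕ) : TopologicalSpace (S.GroupAlg n) :=
  TopologicalSpace.induced (fun a g => a.coeff g) Pi.topologicalSpace

/-- The projective limit `lim ℂGₙ`, a topological algebra as a subalgebra of `∏ ℂGₙ`; the linking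
homomorphisms `ℂGₙ₊₁ → ℂGₙ` are the linear extensions of those of the groups. -/
def groupAlgLimit : Subalgebra ℂ (∀ n, S.GroupAlg n) where
  carrier := {a | ∀ n, MonoidAlgebra.mapDomainAlgHom ℂ ℂ (S.link n) (a (n + 1)) = a n}
  mul_mem' := by
    intro a b ha hb n
    simp only [Pi.mul_apply, map_mul, ha n, hb n]
  add_mem' := by
    intro a b ha hb n
    simp only [Pi.add_apply, map_add, ha n, hb n]
  algebraMap_mem' := by
    intro r n
    simp only [Pi.algebraMap_apply, AlgHom.commutes]

variable {S} {G : Type u} [Group G] [TopologicalSpace G]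

/-- The projection `G → Gₙ` when `G` is identified with `lim Gₙ`. -/
def proj (e : G ≃ₜ* S.limit) (n : ℕ) : G → S.obj n := fun x => (e x : ∀ n, S.obj n) n

theorem continuous_proj (e : G ≃ₜ* S.limit) (n : ℕ) : Continuous (proj e n) :=
  (continuous_apply n).comp (continuous_subtype_val.comp e.continuous)

/-- The map `ℂ^{Gₙ} → 𝒪(G)`, the composition with the projection `G → Gₙ`. -/
def pullback (e : G ≃ₜ* S.limit) (n : ℕ) (h : S.obj n → ℂ) : HolFun G :=
  ⟨fun x => h (proj e n x),
    ((IsLocallyConstant.iff_continuous _).2 (continuous_proj e n)).comp h⟩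

end FiniteGroupSeq

end

/-! Every linear functional on `𝒪(G)` is continuous, so a bounded set contains no infinite
independent family: it lies in a finite-dimensional span, with bounded coordinates. Hence the strong
topology of `𝒪(G)'` is pointwise convergence (`isInducing_dualEval`), and the dual is the full
algebraic dual, closed in a product of copies of `ℂ`.

If `G = lim Gₙ`, compactness makes every locally constant function factor through some `Gₙ`
(`exists_pullback_eq`). A functional on `𝒪(G)` is therefore a coherent family of functionals on the
spaces `ℂ^{Gₙ}`, i.e. of elements of `ℂGₙ`, under the pairing `∑ c_g h(g)`. Since `G → Gₙ` need not
be surjective, a second compactness argument (`pairing_eq_zero`) shows that a coherent family does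
not see values of `h` off the image of `G`. The `ℓ¹`-norms of the `ℂGₙ` pull back to the required
submultiplicative seminorms. -/

noncomputable section

open Topology Filter

/-! ### The strong dual of `𝒪(G)` -/

namespace HolFun

section DualTopology

variable {G : Type u} [TopologicalSpace G] [CompactSpace G]

theorem exists_bound_of_isVonNBounded {B : Set (HolFun G)} (hB : Bornology.IsVonNBounded ℂ B)
    (T : HolFun G →ₗ[ℂ] ℂ) : ∃ M : ℝ, ∀ f ∈ B, ‖T f‖ ≤ M := by
  have h := hB.image (⟨T, continuous_linear T⟩ : StrongDual ℂ (HolFun G))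
  obtain ⟨M, hM⟩ := isBounded_iff_forall_norm_le.1 ((NormedSpace.isVonNBounded_iff ℂ).1 h)
  exact ⟨M, fun f hf => hM _ ⟨f, hf, rfl⟩⟩

/-- A linearly independent bounded set is finite, as otherwise some linear functional would be
unbounded on it. -/
theorem finite_of_isVonNBounded_of_linearIndependent {b : Set (HolFun G)}
    (hb : Bornology.IsVonNBounded ℂ b) (hli : LinearIndependent ℂ ((↑) : b → HolFun G)) :
    b.Finite := by
  by_contra hinf
  let i := Set.Infinite.natEmbedding b hinf
  -- Growing values along a sequence of independent vectors give a functional unbounded on `b`; the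
  -- value 0 elsewhere is immaterial.
  let u : b → ℂ := Function.extend i (fun n => (n : ℂ)) 0
  obtain ⟨T, hT⟩ := (Module.Basis.span hli).constr ℂ u |>.exists_extend
  have hTi (n : ℕ) : T (i n : HolFun G) = n := by
    have h1 : T (i n : HolFun G) =
        (Module.Basis.span hli).constr ℂ u (Module.Basis.span hli (i n)) := by
      rw [← hT, LinearMap.comp_apply, Submodule.subtype_apply, Module.Basis.span_apply]
    rw [h1, Module.Basis.constr_basis]
    exact i.injective.extend_apply _ _ n
  obtain ⟨M, hM⟩ := exists_bound_of_isVonNBounded hb T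
  obtain ⟨n, hn⟩ := exists_nat_gt M
  have := hM _ (i n).2
  rw [hTi, Complex.norm_natCast] at this
  exact absurd hn this.not_gt

/-- On a bounded subset of `𝒪(G)` all functionals are controlled by their values on a finite set. -/
theorem exists_finset_bound {B : Set (HolFun G)} (hB : Bornology.IsVonNBounded ℂ B) :
    ∃ (s : Finset (HolFun G)) (M : ℝ), 0 ≤ M ∧
      ∀ f ∈ B, ∀ T : HolFun G →ₗ[ℂ] ℂ, ‖T f‖ ≤ M * ∑ b ∈ s, ‖T b‖ := by
  obtain ⟨b, hbB, hspan, hli⟩ := exists_linearIndependent ℂ B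
  have hfin : Finite b := finite_of_isVonNBounded_of_linearIndependent (hB.subset hbB) hli
  have := Fintype.ofFinite b
  -- Each coordinate extends from the span to a functional on `𝒪(G)`, hence is bounded on `B`.
  have hcoord : ∀ i : b, ∃ M : ℝ, ∀ f (hf : f ∈ B),
      ‖(Module.Basis.span hli).repr ⟨f, by
        rw [Subtype.range_coe, hspan]; exact Submodule.subset_span hf⟩ i‖ ≤ M := by
    intro i
    obtain ⟨T, hT⟩ := ((Module.Basis.span hli).coord i).exists_extend
    obtain ⟨M, hM⟩ := exists_bound_of_isVonNBounded hB T
    refine ⟨M, fun f hf => ?_⟩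
    rw [← Module.Basis.coord_apply, ← hT]
    exact hM f hf
  choose M hM using hcoord
  refine ⟨Finset.univ.map (Function.Embedding.subtype (· ∈ b)), ∑ i, |M i|,
    Finset.sum_nonneg fun i _ => abs_nonneg _, fun f hf T => ?_⟩
  have hmem : f ∈ Submodule.span ℂ (Set.range ((↑) : b → HolFun G)) := by
    rw [Subtype.range_coe, hspan]; exact Submodule.subset_span hf
  have hsum := congrArg (Submodule.subtype _) ((Module.Basis.span hli).sum_repr ⟨f, hmem⟩)
  simp only [map_sum, map_smul, Submodule.subtype_apply, Module.Basis.span_apply] at hsum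
  calc ‖T f‖ = ‖∑ i : b, (Module.Basis.span hli).repr ⟨f, hmem⟩ i • T i‖ := by
        conv_lhs => rw [← hsum]
        simp
    _ ≤ ∑ i : b, |M i| * ‖T i‖ := by
        refine (norm_sum_le _ _).trans (Finset.sum_le_sum fun i _ => ?_)
        rw [norm_smul]
        gcongr
        exact (hM i f hf).trans (le_abs_self _)
    _ ≤ ∑ i : b, (∑ j, |M j|) * ‖T i‖ := by
        refine Finset.sum_le_sum fun i _ => ?_
        gcongr
        exact Finset.single_le_sum (f := fun j => |M j|) (fun j _ => abs_nonneg _)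
          (Finset.mem_univ i)
    _ = _ := by rw [Finset.sum_map, Finset.mul_sum]; rfl

/-- The evaluations of functionals, as a homomorphism to the product `∏ ℂ`. -/
def dualEval : StrongDual ℂ (HolFun G) →+ (HolFun G → ℂ) where
  toFun T f := T f
  map_zero' := rfl
  map_add' _ _ := rfl

theorem continuous_dual_apply (f : HolFun G) :
    Continuous fun T : StrongDual ℂ (HolFun G) => T f :=
  continuous_eval_const f

/-- The strong topology of `𝒪(G)'` is the topology of pointwise convergence. -/
theorem isInducing_dualEval : IsInducing (dualEval (G := G)) := by
  refine ⟨IsTopologicalAddGroup.ext inferInstance (topologicalAddGroup_induced _) ?_⟩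
  refine le_antisymm (tendsto_id'.1 ?_) ?_
  · rw [nhds_induced, tendsto_comap_iff]
    exact (continuous_pi continuous_dual_apply).tendsto' _ _ rfl
  -- Smallness on a bounded set `B` follows from smallness on the finite set `s`, a pointwise
  -- condition.
  · rw [(ContinuousLinearMap.hasBasis_nhds_zero_of_basis
      (Metric.nhds_basis_ball (x := (0 : ℂ)))).ge_iff]
    rintro ⟨B, ε⟩ ⟨hB, hε⟩
    obtain ⟨s, M, hM, hs⟩ := exists_finset_bound hB
    rw [nhds_induced]
    have hc : Continuous fun F : HolFun G → ℂ => M * ∑ b ∈ s, ‖F b‖ := by fun_prop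
    have h0 : ∀ᶠ F in 𝓝 (dualEval (0 : StrongDual ℂ (HolFun G))), M * ∑ b ∈ s, ‖F b‖ < ε := by
      refine hc.continuousAt.eventually_lt_const ?_
      simpa [dualEval] using hε
    filter_upwards [preimage_mem_comap h0] with T hT f hf
    rw [mem_ball_zero_iff]
    exact (hs f hf T).trans_lt hT

theorem t2Space_dual : T2Space (StrongDual ℂ (HolFun G)) :=
  T2Space.of_injective_continuous (f := dualEval)
    (fun _ _ h => ContinuousLinearMap.ext fun f => congrFun h f) isInducing_dualEval.continuous

/-- Since continuity is automatic, the image in the product is cut out by linearity alone, a closed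
condition. -/
theorem completeSpace_dual : CompleteSpace (StrongDual ℂ (HolFun G)) := by
  have hui := AddMonoidHom.isUniformInducing_of_isInducing (isInducing_dualEval (G := G))
  rw [completeSpace_iff_isComplete_range hui]
  have hrange : Set.range (dualEval (G := G)) =
      Set.range ((⇑) : (HolFun G →ₗ[ℂ] ℂ) → HolFun G → ℂ) := by
    ext F
    constructor
    · rintro ⟨T, rfl⟩
      exact ⟨T, rfl⟩
    · rintro ⟨T, rfl⟩
      exact ⟨⟨T, continuous_linear T⟩, rfl⟩
  rw [hrange]
  exact (LinearMap.isClosed_range_coe _ _ _).isComplete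

end DualTopology

end HolFun

/-! ### Pairing of a monoid algebra with functions -/

namespace MonoidAlgebra

variable {M N : Type*}

/-- The value `∑ c_g h(g)` at `∑ c_g g` of the linear extension of `h`. -/
def pairing (h : M → ℂ) : MonoidAlgebra ℂ M →ₗ[ℂ] ℂ where
  toFun a := a.coeff.sum fun g c => c * h g
  map_add' a b := (Finsupp.linearCombination ℂ h).map_add a.coeff b.coeff
  map_smul' c a := (Finsupp.linearCombination ℂ h).map_smul c a.coeff

theorem pairing_apply (h : M → ℂ) (a : MonoidAlgebra ℂ M) :
    pairing h a = a.coeff.sum fun g c => c * h g := rfl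

@[simp] theorem pairing_single (h : M → ℂ) (g : M) (c : ℂ) :
    pairing h (single g c) = c * h g :=
  (Finsupp.sum_single_index (h := fun g c => c * h g) (zero_mul _))

theorem pairing_eq_sum [Fintype M] (h : M → ℂ) (a : MonoidAlgebra ℂ M) :
    pairing h a = ∑ g, a.coeff g * h g :=
  Finsupp.sum_fintype a.coeff (fun g c => c * h g) fun _ => zero_mul _

theorem pairing_add (h h' : M → ℂ) (a : MonoidAlgebra ℂ M) :
    pairing (h + h') a = pairing h a + pairing h' a := by
  simp only [pairing_apply, Pi.add_apply, mul_add, Finsupp.sum_add]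

theorem pairing_smul (c : ℂ) (h : M → ℂ) (a : MonoidAlgebra ℂ M) :
    pairing (c • h) a = c * pairing h a := by
  simp only [pairing_apply, Pi.smul_apply, smul_eq_mul,
    mul_left_comm _ c, Finsupp.mul_sum]

theorem pairing_piSingle [DecidableEq M] (g : M) (a : MonoidAlgebra ℂ M) :
    pairing (Pi.single g 1) a = a.coeff g := by
  simp only [pairing_apply, Pi.single_apply, mul_ite, mul_one, mul_zero,
    Finsupp.sum_ite_self_eq']

theorem ext_pairing {a b : MonoidAlgebra ℂ M} (hab : ∀ h, pairing h a = pairing h b) : a = b := by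
  classical
  refine coeff_injective (Finsupp.ext fun g => ?_)
  rw [← pairing_piSingle, hab, pairing_piSingle]

theorem pairing_mapDomainAlgHom [Monoid M] [Monoid N] (φ : M →* N) (h : N → ℂ)
    (a : MonoidAlgebra ℂ M) :
    pairing h (mapDomainAlgHom ℂ ℂ φ a) = pairing (h ∘ φ) a := by
  have : pairing h ∘ₗ (mapDomainAlgHom ℂ ℂ φ).toLinearMap = pairing (h ∘ φ) := by
    ext; simp
  exact LinearMap.congr_fun this a

/-- The finite-level form of the convolution formula, which makes `𝒪(G)' → ℂGₙ` multiplicative. By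
linearity it suffices to check basis elements. -/
theorem pairing_mul [Monoid M] (h : M → ℂ) (a b : MonoidAlgebra ℂ M) :
    pairing h (a * b) = pairing (fun x => pairing (fun y => h (x * y)) b) a := by
  have hleft (x : M) : pairing h ∘ₗ LinearMap.mulLeft ℂ (single x 1) =
      pairing (fun y => h (x * y)) := by
    ext; simp
  have hright : pairing h ∘ₗ LinearMap.mulRight ℂ b =
      pairing (fun x => pairing (fun y => h (x * y)) b) := by
    ext x
    simpa using LinearMap.congr_fun (hleft x) b
  exact LinearMap.congr_fun hright a

theorem pairing_one [Monoid M] (h : M → ℂ) : pairing h 1 = h 1 := by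
  rw [one_def, pairing_single, one_mul]

/-- The `ℓ¹`-norm on the algebra of a finite monoid is submultiplicative. -/
theorem sum_norm_coeff_mul_le [Fintype M] [Monoid M] (a b : MonoidAlgebra ℂ M) :
    ∑ g, ‖(a * b).coeff g‖ ≤ (∑ g, ‖a.coeff g‖) * ∑ g, ‖b.coeff g‖ := by
  have hbound (h : M → ℂ) (C : ℝ) (hh : ∀ g, ‖h g‖ ≤ C) (a : MonoidAlgebra ℂ M) :
      ‖pairing h a‖ ≤ (∑ g, ‖a.coeff g‖) * C := by
    rw [pairing_eq_sum, Finset.sum_mul]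
    refine (norm_sum_le _ _).trans (Finset.sum_le_sum fun g _ => ?_)
    rw [norm_mul]
    gcongr
    exact hh g
  -- Unimodular phases turn the `ℓ¹`-norm of `a * b` into a pairing, to which `pairing_mul` applies.
  choose c hc1 hc using fun g => Complex.exists_norm_eq_mul_self ((a * b).coeff g)
  have hsum : ((∑ g, ‖(a * b).coeff g‖ : ℝ) : ℂ) = pairing c (a * b) := by
    rw [pairing_eq_sum, Complex.ofReal_sum]
    exact Finset.sum_congr rfl fun g _ => (hc g).trans (mul_comm _ _)
  calc ∑ g, ‖(a * b).coeff g‖ ≤ ‖((∑ g, ‖(a * b).coeff g‖ : ℝ) : ℂ)‖ := by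
        rw [Complex.norm_real]; exact le_abs_self _
    _ ≤ _ := by
        rw [hsum, pairing_mul]
        refine hbound _ _ (fun x => ?_) a
        exact (hbound _ 1 (fun y => (hc1 _).le) b).trans_eq (mul_one _)

end MonoidAlgebra

/-! ### Compactness in a sequence of finite groups -/

namespace FiniteGroupSeq

section Thread

variable (S : FiniteGroupSeq.{v})

/-- The element of `∏ Gₖ` formed by the images of `g ∈ Gₘ` in all `Gₖ` with `k ≤ m`, and by the
identity for `k > m`. -/
def thread : ∀ m, S.obj m → ∀ k, S.obj k
  | 0, g => Function.update 1 0 g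
  | m + 1, g => Function.update (thread m (S.link m g)) (m + 1) g

theorem thread_self (m : ℕ) (g : S.obj m) : S.thread m g m = g := by
  cases m <;> simp [thread]

theorem thread_succ_of_le {n m : ℕ} (h : n ≤ m) (g : S.obj (m + 1)) :
    S.thread (m + 1) g n = S.thread m (S.link m g) n := by
  rw [thread, Function.update_of_ne (by omega)]

theorem link_thread {k m : ℕ} (h : k < m) (g : S.obj m) :
    S.link k (S.thread m g (k + 1)) = S.thread m g k := by
  induction m with
  | zero => omega
  | succ m ih =>
    rw [S.thread_succ_of_le (Nat.lt_succ_iff.1 h)]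
    rcases (Nat.lt_succ_iff.1 h).eq_or_lt with rfl | hlt
    · rw [thread_self, thread_self]
    · rw [S.thread_succ_of_le hlt, ih hlt]

/-- A function on `Gₙ` that vanishes on the image of `lim Gₖ` vanishes on the image of some
`Gₘ`. -/
theorem exists_forall_thread_eq_zero {n : ℕ} {h : S.obj n → ℂ}
    (hh : ∀ x ∈ S.limit, h (x n) = 0) : ∃ m, n ≤ m ∧ ∀ g, h (S.thread m g n) = 0 := by
  by_contra! hne
  -- Only the first `j` coherence conditions are imposed, so threads from a high enough level lie in
  -- `C j`; a point of the intersection is in the limit.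
  let C (j : ℕ) : Set (∀ k, S.obj k) :=
    {x | h (x n) ≠ 0} ∩ ⋂ k < j, {x | S.link k (x (k + 1)) = x k}
  have hclosed (j : ℕ) : IsClosed (C j) := by
    refine IsClosed.inter ?_ (isClosed_biInter fun k _ => isClosed_eq ?_ (continuous_apply k))
    · exact (isClosed_discrete {y | h y ≠ 0}).preimage (continuous_apply n)
    · exact continuous_of_discreteTopology.comp (continuous_apply (k + 1))
  obtain ⟨x, hx⟩ := IsCompact.nonempty_iInter_of_sequence_nonempty_isCompact_isClosed C
    (fun j => Set.inter_subset_inter_right _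
      (Set.biInter_subset_biInter_left fun k (hk : k < j) => Nat.lt_succ_of_lt hk))
    (fun j => by
      obtain ⟨g, hg⟩ := hne (max n j) (le_max_left _ _)
      exact ⟨S.thread _ g, hg, Set.mem_iInter₂.2 fun k hk =>
        S.link_thread (hk.trans_le (le_max_right _ _)) g⟩)
    (hclosed 0).isCompact hclosed
  rw [Set.mem_iInter] at hx
  exact (hx 0).1 (hh x fun k => Set.mem_iInter₂.1 (hx (k + 1)).2 k k.lt_succ_self)

theorem pairing_thread {a : ∀ n, S.GroupAlg n} (ha : a ∈ S.groupAlgLimit) {n m : ℕ} (hnm : n ≤ m)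
    (h : S.obj n → ℂ) :
    MonoidAlgebra.pairing (fun g => h (S.thread m g n)) (a m) = MonoidAlgebra.pairing h (a n) := by
  induction m, hnm using Nat.le_induction with
  | base => simp only [thread_self]
  | succ m hnm ih =>
    rw [← ih, ← ha m, MonoidAlgebra.pairing_mapDomainAlgHom]
    simp only [S.thread_succ_of_le hnm, Function.comp_def]

/-- Replaces surjectivity of the projections: at a late enough level `m` the transported function is
identically zero. -/
theorem pairing_eq_zero {a : ∀ n, S.GroupAlg n} (ha : a ∈ S.groupAlgLimit) {n : ℕ}
    {h : S.obj n → ℂ} (hh : ∀ x ∈ S.limit, h (x n) = 0) :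
    MonoidAlgebra.pairing h (a n) = 0 := by
  obtain ⟨m, hnm, hm⟩ := S.exists_forall_thread_eq_zero hh
  rw [← S.pairing_thread ha hnm]
  simp [hm, MonoidAlgebra.pairing_apply]

end Thread

end FiniteGroupSeq

/-! ### Functionals on `𝒪(G)` as coherent families -/

namespace FiniteGroupSeq

section Limit

variable {S : FiniteGroupSeq.{v}}

theorem thread_eq_of_mem_limit {x : ∀ n, S.obj n} (hx : x ∈ S.limit) {n m : ℕ} (hnm : n ≤ m) :
    S.thread m (x m) n = x n := by
  induction m, hnm using Nat.le_induction with
  | base => exact S.thread_self _ _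
  | succ m hnm ih => rw [S.thread_succ_of_le hnm, hx m, ih]

variable {G : Type u} [Group G] [TopologicalSpace G] (e : G ≃ₜ* S.limit)

@[simp] theorem pullback_apply (n : ℕ) (h : S.obj n → ℂ) (x : G) :
    pullback e n h x = h (proj e n x) := rfl

@[simp] theorem proj_mul (n : ℕ) (x y : G) : proj e n (x * y) = proj e n x * proj e n y := by
  simp [proj]

@[simp] theorem proj_one (n : ℕ) : proj e n 1 = 1 := by
  simp [proj]

theorem link_proj (n : ℕ) (x : G) : S.link n (proj e (n + 1) x) = proj e n x :=
  (e x).2 n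

theorem pullback_thread {n m : ℕ} (hnm : n ≤ m) (h : S.obj n → ℂ) :
    pullback e m (fun g => h (S.thread m g n)) = pullback e n h := by
  ext x
  exact congrArg h (thread_eq_of_mem_limit (e x).2 hnm)

/-- The pairing of a coherent family with a function pulled back from some `Gₙ` depends only on
the pulled back function. -/
theorem pairing_eq_of_pullback_eq {a : ∀ n, S.GroupAlg n} (ha : a ∈ S.groupAlgLimit) {n m : ℕ}
    {h : S.obj n → ℂ} {h' : S.obj m → ℂ} (hh : pullback e n h = pullback e m h') :
    MonoidAlgebra.pairing h (a n) = MonoidAlgebra.pairing h' (a m) := by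
  wlog hnm : n ≤ m generalizing n m
  · exact (this hh.symm (le_of_not_ge hnm)).symm
  -- Both functions are brought to level `m`, where their difference vanishes on the image of the
  -- limit.
  rw [← S.pairing_thread ha hnm, ← sub_eq_zero, sub_eq_add_neg, ← neg_one_mul,
    ← MonoidAlgebra.pairing_smul, ← MonoidAlgebra.pairing_add]
  refine S.pairing_eq_zero ha fun x hx => ?_
  have hx' := DFunLike.congr_fun hh (e.symm ⟨x, hx⟩)
  simp only [pullback_apply, proj, ContinuousMulEquiv.apply_symm_apply] at hx'
  simp [thread_eq_of_mem_limit hx hnm, hx']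

/-- Every locally constant function on `G` factors through some `Gₙ`. -/
theorem exists_pullback_eq [CompactSpace G] (f : HolFun G) :
    ∃ (n : ℕ) (h : S.obj n → ℂ), pullback e n h = f := by
  suffices ∃ n, ∀ x y, proj e n x = proj e n y → f x = f y by
    obtain ⟨n, hn⟩ := this
    refine ⟨n, Function.extend (proj e n) f 0, ?_⟩
    ext x
    exact Function.FactorsThrough.extend_apply (fun x y => hn x y) _ x
  by_contra! hne
  -- A pair in all of these nested compact sets would have equal components, yet distinct values of
  -- `f`.
  let C (n : ℕ) : Set (G × G) := {p | proj e n p.1 = proj e n p.2} ∩ {p | f p.1 ≠ f p.2}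
  have hclosed (n : ℕ) : IsClosed (C n) := by
    refine IsClosed.inter (isClosed_eq ((continuous_proj e n).comp continuous_fst)
      ((continuous_proj e n).comp continuous_snd)) ?_
    have h1 : IsLocallyConstant fun p : G × G => f p.1 :=
      f.isLocallyConstant.comp_continuous continuous_fst
    have h2 : IsLocallyConstant fun p : G × G => f p.2 :=
      f.isLocallyConstant.comp_continuous continuous_snd
    exact ⟨(h1.prodMk h2) {q | q.1 ≠ q.2}ᶜ⟩
  obtain ⟨⟨x, y⟩, hxy⟩ := IsCompact.nonempty_iInter_of_sequence_nonempty_isCompact_isClosed C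
    (fun n p hp => ⟨by
      have := congrArg (S.link n) hp.1
      rwa [link_proj, link_proj] at this, hp.2⟩)
    (fun n => by
      obtain ⟨x, y, h, h'⟩ := hne n
      exact ⟨(x, y), h, h'⟩)
    (hclosed 0).isCompact hclosed
  rw [Set.mem_iInter] at hxy
  have : x = y := e.injective (Subtype.ext (funext fun n => (hxy n).1))
  exact (hxy 0).2 (congrArg f this)

theorem exists_pullback_eq_and_pullback_eq [CompactSpace G] (f f' : HolFun G) :
    ∃ (n : ℕ) (h h' : S.obj n → ℂ), pullback e n h = f ∧ pullback e n h' = f' := by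
  obtain ⟨n, h, rfl⟩ := exists_pullback_eq e f
  obtain ⟨m, h', rfl⟩ := exists_pullback_eq e f'
  exact ⟨max n m, _, _, pullback_thread e (le_max_left n m) h,
    pullback_thread e (le_max_right n m) h'⟩

variable [CompactSpace G]

/-- The image in `ℂGₙ` of a functional on `𝒪(G)`. -/
def pushforward (n : ℕ) (T : StrongDual ℂ (HolFun G)) : S.GroupAlg n :=
  .ofCoeff <| Finsupp.equivFunOnFinite.symm fun g => T (pullback e n (Set.indicator {g} 1))

theorem coeff_pushforward (n : ℕ) (T : StrongDual ℂ (HolFun G)) (g : S.obj n) :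
    (pushforward e n T).coeff g = T (pullback e n (Set.indicator {g} 1)) := rfl

theorem pairing_pushforward (n : ℕ) (T : StrongDual ℂ (HolFun G)) (h : S.obj n → ℂ) :
    MonoidAlgebra.pairing h (pushforward e n T) = T (pullback e n h) := by
  classical
  have := Fintype.ofFinite (S.obj n)
  have hsum : pullback e n h = ∑ g, h g • pullback e n (Set.indicator {g} 1) := by
    ext x
    have := map_sum (LocallyConstant.evalₗ ℂ x : HolFun G →ₗ[ℂ] ℂ)
      (fun g => h g • pullback e n (Set.indicator {g} 1)) Finset.univ
    simp only [LocallyConstant.evalₗ_apply] at this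
    rw [this]
    simp [Pi.single_apply]
  rw [MonoidAlgebra.pairing_eq_sum, hsum, map_sum]
  exact Finset.sum_congr rfl fun g _ => by
    rw [map_smul, smul_eq_mul, mul_comm, coeff_pushforward]

/-- A linear functional on `𝒪(G)` is determined by a coherent family of elements of `ℂGₙ`. -/
theorem exists_pushforward_eq {a : ∀ n, S.GroupAlg n} (ha : a ∈ S.groupAlgLimit) :
    ∃ T : StrongDual ℂ (HolFun G), ∀ n, pushforward e n T = a n := by
  choose N H hNH using exists_pullback_eq (G := G) e
  -- Independence of the chosen representative; it allows linearity to be checked at a common level.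
  have hval {n : ℕ} {h : S.obj n → ℂ} {f : HolFun G} (hf : pullback e n h = f) :
      MonoidAlgebra.pairing (H f) (a (N f)) = MonoidAlgebra.pairing h (a n) :=
    pairing_eq_of_pullback_eq e ha ((hNH f).trans hf.symm)
  let L : HolFun G →ₗ[ℂ] ℂ :=
    { toFun f := MonoidAlgebra.pairing (H f) (a (N f))
      map_add' f f' := by
        obtain ⟨n, h, h', hf, hf'⟩ := exists_pullback_eq_and_pullback_eq e f f'
        rw [hval hf, hval hf', ← MonoidAlgebra.pairing_add]
        exact hval (by rw [← hf, ← hf']; rfl)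
      map_smul' c f := by
        rw [RingHom.id_apply, smul_eq_mul, ← MonoidAlgebra.pairing_smul]
        exact hval (by conv_rhs => rw [← hNH f]
                       rfl) }
  refine ⟨⟨L, HolFun.continuous_linear L⟩, fun n => MonoidAlgebra.ext_pairing fun h => ?_⟩
  rw [pairing_pushforward]
  exact hval rfl

/-- `pushforward` as a linear map. -/
def pushforwardₗ (n : ℕ) : StrongDual ℂ (HolFun G) →ₗ[ℂ] S.GroupAlg n where
  toFun := pushforward e n
  map_add' _ _ := MonoidAlgebra.coeff_injective (Finsupp.ext fun _ => rfl)
  map_smul' _ _ := MonoidAlgebra.coeff_injective (Finsupp.ext fun _ => rfl)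

@[simp] theorem pushforwardₗ_apply (n : ℕ) (T : StrongDual ℂ (HolFun G)) :
    pushforwardₗ e n T = pushforward e n T := rfl

theorem pushforward_mem_groupAlgLimit (T : StrongDual ℂ (HolFun G)) :
    (fun n => pushforward e n T) ∈ S.groupAlgLimit := fun n =>
  MonoidAlgebra.ext_pairing fun h => by
    rw [MonoidAlgebra.pairing_mapDomainAlgHom, pairing_pushforward, pairing_pushforward]
    refine congrArg T (LocallyConstant.ext fun x => ?_)
    simp [link_proj]

/-! ### The isomorphism of topological algebras and the seminorms -/

variable [IsTopologicalGroup G]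

/-- The homomorphism `𝒪(G)' → ℂGₙ`. -/
def pushforwardAlgHom (n : ℕ) : StrongDual ℂ (HolFun G) →ₐ[ℂ] S.GroupAlg n :=
  AlgHom.ofLinearMap (pushforwardₗ e n)
    (MonoidAlgebra.ext_pairing fun h => by
      rw [pushforwardₗ_apply, pairing_pushforward, MonoidAlgebra.pairing_one,
        HolFun.one_dual_apply, pullback_apply, proj_one])
    (fun T U => MonoidAlgebra.ext_pairing fun h => by
      simp only [pushforwardₗ_apply]
      rw [pairing_pushforward, MonoidAlgebra.pairing_mul, HolFun.mul_dual_apply]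
      refine Eq.trans (congrArg T (LocallyConstant.ext fun x => ?_))
        (pairing_pushforward e n T _).symm
      rw [HolFun.slice_apply, pullback_apply, pairing_pushforward]
      refine congrArg U (LocallyConstant.ext fun y => ?_)
      simp)

@[simp] theorem pushforwardAlgHom_apply (n : ℕ) (T : StrongDual ℂ (HolFun G)) :
    pushforwardAlgHom e n T = pushforward e n T := rfl

/-- The isomorphism of algebras `𝒪(G)' ≃ lim ℂGₙ`. -/
def dualAlgEquiv : StrongDual ℂ (HolFun G) ≃ₐ[ℂ] S.groupAlgLimit :=
  AlgEquiv.ofBijective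
    ((AlgHom.pi (pushforwardAlgHom e)).codRestrict S.groupAlgLimit (pushforward_mem_groupAlgLimit e))
    ⟨fun T U hTU => by
      ext f
      obtain ⟨n, h, rfl⟩ := exists_pullback_eq e f
      rw [← pairing_pushforward, ← pairing_pushforward]
      exact congrArg (MonoidAlgebra.pairing h) (congrFun (congrArg Subtype.val hTU) n),
    fun a => by
      obtain ⟨T, hT⟩ := exists_pushforward_eq e a.2
      exact ⟨T, Subtype.ext (funext hT)⟩⟩

theorem dualAlgEquiv_apply (T : StrongDual ℂ (HolFun G)) (n : ℕ) :
    (dualAlgEquiv e T : ∀ k, S.GroupAlg k) n = pushforward e n T := rfl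

theorem continuous_pairing (n : ℕ) (h : S.obj n → ℂ) :
    Continuous fun a : S.GroupAlg n => MonoidAlgebra.pairing h a := by
  have := Fintype.ofFinite (S.obj n)
  simp only [MonoidAlgebra.pairing_eq_sum]
  have hcoeff : Continuous fun (a : S.GroupAlg n) g => a.coeff g := continuous_induced_dom
  exact continuous_finsetSum _ fun g _ =>
    ((continuous_apply g).comp hcoeff).mul continuous_const

/-- The isomorphism of topological algebras `𝒪(G)' ≃ lim ℂGₙ`. -/
def dualContinuousAlgEquiv : StrongDual ℂ (HolFun G) ≃A[ℂ] S.groupAlgLimit where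
  __ := dualAlgEquiv e
  continuous_toFun := by
    refine Continuous.subtype_mk (continuous_pi fun n => continuous_induced_rng.2 ?_) _
    exact continuous_pi fun g => HolFun.continuous_dual_apply _
  continuous_invFun := by
    -- It suffices to treat evaluation at one `f`, which depends on a single component of the
    -- family.
    refine HolFun.isInducing_dualEval.continuous_iff.2 (continuous_pi fun f => ?_)
    obtain ⟨n, h, rfl⟩ := exists_pullback_eq e f
    have hcont : Continuous fun a : S.groupAlgLimit =>
        MonoidAlgebra.pairing h ((a : ∀ k, S.GroupAlg k) n) :=
      (continuous_pairing n h).comp ((continuous_apply n).comp continuous_subtype_val)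
    refine hcont.congr fun a => ?_
    obtain ⟨T, rfl⟩ := (dualAlgEquiv e).surjective a
    rw [dualAlgEquiv_apply, pairing_pushforward]
    exact congrArg (fun U : StrongDual ℂ (HolFun G) => U _)
      ((dualAlgEquiv e).symm_apply_apply T).symm

/-- The seminorm on `𝒪(G)'` induced by the `ℓ¹`-norm of `ℂGₙ`. -/
def dualSeminorm (n : ℕ) : Seminorm ℂ (StrongDual ℂ (HolFun G)) :=
  letI := Fintype.ofFinite (S.obj n)
  Seminorm.of (fun T => ∑ g, ‖(pushforward e n T).coeff g‖)
    (fun T U => by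
      rw [← Finset.sum_add_distrib]
      exact Finset.sum_le_sum fun g _ => norm_add_le _ _)
    (fun c T => by
      rw [Finset.mul_sum]
      exact Finset.sum_congr rfl fun g _ => norm_mul _ _)

theorem dualSeminorm_mul_le (n : ℕ) (T U : StrongDual ℂ (HolFun G)) :
    dualSeminorm e n (T * U) ≤ dualSeminorm e n T * dualSeminorm e n U := by
  let _ := Fintype.ofFinite (S.obj n)
  have hmul := map_mul (pushforwardAlgHom e n) T U
  simp only [pushforwardAlgHom_apply] at hmul
  change ∑ g, ‖(pushforward e n (T * U)).coeff g‖ ≤ _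
  rw [hmul]
  exact MonoidAlgebra.sum_norm_coeff_mul_le _ _

theorem continuous_dualSeminorm (n : ℕ) : Continuous (dualSeminorm (S := S) e n) := by
  let _ := Fintype.ofFinite (S.obj n)
  exact continuous_finsetSum _ fun g _ => (HolFun.continuous_dual_apply _).norm

theorem norm_dual_apply_le (n : ℕ) (h : S.obj n → ℂ) :
    ∃ C : ℝ, ∀ T : StrongDual ℂ (HolFun G), ‖T (pullback e n h)‖ ≤ dualSeminorm e n T * C := by
  let _ := Fintype.ofFinite (S.obj n)
  refine ⟨∑ g, ‖h g‖, fun T => ?_⟩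
  rw [← pairing_pushforward, MonoidAlgebra.pairing_eq_sum]
  change _ ≤ (∑ g, ‖(pushforward e n T).coeff g‖) * _
  rw [Finset.sum_mul]
  refine (norm_sum_le _ _).trans (Finset.sum_le_sum fun g _ => ?_)
  rw [norm_mul]
  gcongr
  exact Finset.single_le_sum (f := fun g => ‖h g‖) (fun _ _ => norm_nonneg _) (Finset.mem_univ g)

/-- Each seminorm is a finite sum of norms of evaluations, and conversely each evaluation is
dominated by a multiple of one seminorm; the topology is that of pointwise convergence. -/
theorem withSeminorms_dualSeminorm :
    WithSeminorms fun p : Set.range (dualSeminorm (S := S) e) =>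
      (p : Seminorm ℂ (StrongDual ℂ (HolFun G))) := by
  rw [SeminormFamily.withSeminorms_iff_nhds_eq_iInf]
  refine le_antisymm (le_iInf ?_) ?_
  · rintro ⟨_, n, rfl⟩
    exact tendsto_iff_comap.1 ((continuous_dualSeminorm e n).tendsto' _ _ (map_zero _))
  · rw [HolFun.isInducing_dualEval.nhds_eq_comap, ← tendsto_iff_comap, tendsto_pi_nhds]
    intro f
    obtain ⟨n, h, rfl⟩ := exists_pullback_eq e f
    obtain ⟨C, hC⟩ := norm_dual_apply_le e n h
    refine Tendsto.mono_left ?_ (iInf_le _ ⟨_, n, rfl⟩)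
    refine squeeze_zero_norm (hC ·) ?_
    have := (tendsto_comap (f := dualSeminorm (S := S) e n) (x := 𝓝 0)).mul_const C
    rwa [zero_mul] at this

theorem isArensMichaelAlgebra_dual (e : G ≃ₜ* S.limit) :
    IsArensMichaelAlgebra (StrongDual ℂ (HolFun G)) where
  isUniformAddGroup := inferInstance
  t2Space := HolFun.t2Space_dual
  completeSpace := HolFun.completeSpace_dual
  exists_seminorms := ⟨Set.range (dualSeminorm (S := S) e), by
    rintro _ ⟨n, rfl⟩
    exact dualSeminorm_mul_le e n, withSeminorms_dualSeminorm e⟩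

end Limit

/-! ### Profinite groups as limits of sequences -/

section Existence

variable {G : Type u} [Group G]

/-- The sequence of quotients by a decreasing sequence of normal subgroups of finite index. -/
def ofAntitone (N : ℕ → Subgroup G) [∀ n, (N n).Normal] [∀ n, Finite (G ⧸ N n)]
    (hN : Antitone N) : FiniteGroupSeq.{u} where
  obj n := G ⧸ N n
  link n := QuotientGroup.map _ _ (MonoidHom.id G) (hN n.le_succ)

/-- The canonical homomorphism from `G` to the limit of its quotients. -/
def toLimitOfAntitone (N : ℕ → Subgroup G) [∀ n, (N n).Normal] [∀ n, Finite (G ⧸ N n)]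
    (hN : Antitone N) : G →* (ofAntitone N hN).limit where
  toFun x := ⟨fun n => (QuotientGroup.mk x : G ⧸ N n), fun _ => rfl⟩
  map_one' := rfl
  map_mul' _ _ := rfl

variable [TopologicalSpace G] [IsTopologicalGroup G] [CompactSpace G]

theorem nonempty_equiv_limit_ofAntitone [T2Space G] (N : ℕ → Subgroup G) [∀ n, (N n).Normal]
    [∀ n, Finite (G ⧸ N n)] (hN : Antitone N) (hopen : ∀ n, IsOpen (N n : Set G))
    (hinf : ⨅ n, N n = ⊥) : Nonempty (G ≃ₜ* (ofAntitone N hN).limit) := by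
  have hmk (n : ℕ) : IsLocallyConstant (QuotientGroup.mk : G → G ⧸ N n) := by
    have := QuotientGroup.discreteTopology (hopen n)
    exact (IsLocallyConstant.iff_continuous _).2 QuotientGroup.continuous_mk
  have hcont : Continuous (toLimitOfAntitone N hN) :=
    Continuous.subtype_mk (continuous_pi fun n =>
      @IsLocallyConstant.continuous _ _ _ ((ofAntitone N hN).instTopologicalSpaceObj n) _ (hmk n)) _
  have hinj : Function.Injective (toLimitOfAntitone N hN) := by
    rw [injective_iff_map_eq_one]
    intro x hx
    rw [← Subgroup.mem_bot, ← hinf, Subgroup.mem_iInf]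
    exact fun n => (QuotientGroup.eq_one_iff x).1 (congrFun (congrArg Subtype.val hx) n)
  have hsurj : Function.Surjective (toLimitOfAntitone N hN) := by
    rintro ⟨y, hy⟩
    -- These are cosets, nested because `y` is coherent; by compactness they share a point, a
    -- preimage of `y`.
    let C (n : ℕ) : Set G := {x | (QuotientGroup.mk x : G ⧸ N n) = y n}
    have hclosed (n : ℕ) : IsClosed (C n) := (hmk n).isClosed_fiber (y n)
    obtain ⟨x, hx⟩ := IsCompact.nonempty_iInter_of_sequence_nonempty_isCompact_isClosed C
      (fun n x (hx : _ = _) => by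
        have := congrArg ((ofAntitone N hN).link n) hx
        rw [hy n] at this
        exact this)
      (fun n => QuotientGroup.mk_surjective (y n)) (hclosed 0).isCompact hclosed
    exact ⟨x, Subtype.ext (funext fun n => Set.mem_iInter.1 hx n)⟩
  let f := MulEquiv.ofBijective (toLimitOfAntitone N hN) ⟨hinj, hsurj⟩
  exact ⟨{ f with
    continuous_toFun := hcont
    continuous_invFun := (Continuous.homeoOfEquivCompactToT2 (f := f.toEquiv) hcont).symm.continuous }⟩

/-- A profinite group with a countable base is the limit of a sequence of finite groups. -/
theorem exists_equiv_limit [T2Space G] [TotallyDisconnectedSpace G] [FirstCountableTopology G] :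
    ∃ S : FiniteGroupSeq.{u}, Nonempty (G ≃ₜ* S.limit) := by
  obtain ⟨U, hU⟩ := (𝓝 (1 : G)).exists_antitone_basis
  have hsub (n : ℕ) : ∃ H : OpenNormalSubgroup G, (H : Set G) ⊆ U n := by
    obtain ⟨V, hVU, hV, h1⟩ := mem_nhds_iff.1 (hU.1.mem_of_mem (i := n) trivial)
    obtain ⟨H, hH⟩ := ProfiniteGrp.exist_openNormalSubgroup_sub_open_nhds_of_one hV h1
    exact ⟨H, hH.trans hVU⟩
  choose H hH using hsub
  -- Finite intersections make the sequence decreasing; `n + 1` terms ensure that `N n` lies in `H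
  -- n`.
  let N (n : ℕ) : Subgroup G := ⨅ k : Fin (n + 1), (H k).toSubgroup
  have hnormal (n : ℕ) : (N n).Normal := Subgroup.normal_iInf_normal fun k => (H k).isNormal'
  have hopen (n : ℕ) : IsOpen (N n : Set G) := by
    rw [Subgroup.coe_iInf]
    exact isOpen_iInter_of_finite fun k => (H k).isOpen'
  have hfin (n : ℕ) : Finite (G ⧸ N n) := Subgroup.quotient_finite_of_isOpen _ (hopen n)
  have hN : Antitone N := fun n m hnm =>
    le_iInf fun k => iInf_le_of_le (Fin.castLE (by omega) k) le_rfl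
  refine ⟨_, nonempty_equiv_limit_ofAntitone N hN hopen (eq_bot_iff.2 fun x hx => ?_)⟩
  rw [Subgroup.mem_iInf] at hx
  by_contra hne
  obtain ⟨n, -, hn⟩ := hU.1.mem_iff.1 (isOpen_compl_singleton.mem_nhds (Ne.symm hne))
  have hxn : x ∈ H n := iInf_le (fun k : Fin (n + 1) => (H k).toSubgroup) (Fin.last n) (hx n)
  exact hn (hH n hxn) rfl

end Existence

end FiniteGroupSeq

end

theorem proposition7 {G : Type u} [Group G] [TopologicalSpace G] [IsTopologicalGroup G]
    [CompactSpace G] [T2Space G] [TotallyDisconnectedSpace G] [SecondCountableTopology G] :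
    IsArensMichaelAlgebra (StrongDual ℂ (HolFun G)) ∧
    (∃ S : FiniteGroupSeq.{u}, Nonempty (G ≃ₜ* S.limit)) ∧
    ∀ (S : FiniteGroupSeq.{v}) (e : G ≃ₜ* S.limit),
      ∃ Φ : StrongDual ℂ (HolFun G) ≃A[ℂ] S.groupAlgLimit,
        ∀ (T : StrongDual ℂ (HolFun G)) (n : ℕ) (h : S.obj n → ℂ),
          ((Φ T : ∀ k, S.GroupAlg k) n).coeff.sum (fun g c => c * h g) =
            T (FiniteGroupSeq.pullback e n h) := by
  have hS := FiniteGroupSeq.exists_equiv_limit (G := G)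
  -- The Arens–Michael property does not mention a sequence; any one supplies the seminorms.
  obtain ⟨S, ⟨e⟩⟩ := hS
  refine ⟨FiniteGroupSeq.isArensMichaelAlgebra_dual e, ⟨S, ⟨e⟩⟩, fun S e => ?_⟩
  exact ⟨FiniteGroupSeq.dualContinuousAlgEquiv e, fun T n h =>
    FiniteGroupSeq.pairing_pushforward e n T h⟩
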